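/- Let $\mathbb{K}$ be an algebraically closed field (of any characteristic), write $T=(T_1,T_2)$, $X=(X_1,X_2,X_3)$, and let $d=2k>3$. Let $u_1,u_2,u_3\in\mathbb{K}[T]$ be homogeneous of degree $d$ without common factors, and let $C\subset\mathbb{P}^2$ be the image of $\phi=(u_1:u_2:u_3):\mathbb{P}^1\to\mathbb{P}^2$. Assume that $\phi$ is parameterizable by conics: there are quadratic forms $F_1,F_2\in\mathbb{K}[X]$ without common factors such that $\psi=(F_1:F_2):C\dashrightarrow\mathbb{P}^1$ is inverse to $\phi:\mathbb{P}^1\to C$ as a rational map, that is, $\psi(\phi(t))=t$ for all but finitely many $t\in\mathbb{P}^1$ and $\phi(\psi(x))=x$ for all but finitely many $x\in C$. Let $E\in\mathbb{K}[X]$ be an irreducible homogeneous polynomial whose zero locus in $\mathbb{P}^2$ is $C$. Let $I=\langle u_1,u_2,u_3\rangle\subset\mathbb{K}[T]$, let $\mathcal{K}$ be the kernel of the $\mathbb{K}[T]$-algebra homomorphism $\mathbb{K}[T][X]\to\mathrm{Rees}(I)=\mathbb{K}[T][I\,Z]$, $X_i\mapsto u_i(T)Z$, and for an ideal $J$ of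 $\mathbb{K}[T,X]$ let $J_{i,j}$ be the $\mathbb{K}$-vector space of the elements of $J$ that are zero or bihomogeneous of degree $i$ in $T$ and $j$ in $X$. Then there is a nonzero $Q(T,X)\in\mathcal{K}_{k-1,2}$ such that $$Q(F_1(X),F_2(X),X)=E(X),$$ and, as $\mathbb{K}$-vector spaces, $$\mathcal{K}_{k-1,2}=\mathbb{K}\cdot Q(T,X)\ \oplus\ \langle T_1F_2(X)-T_2F_1(X)\rangle_{k-1,2}.$$ -/

import Mathlib

open MvPolynomial
open scoped LinearAlgebra.Projectivization

noncomputable section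

namespace MovingConic

variable {K : Type*} [Field K]

/-- The value `(p 0 (v), …, p (n-1) (v))` of a tuple of polynomials at the vector `v`. -/
def evalTuple {m n : ℕ} (p : Fin n → MvPolynomial (Fin m) K) (v : Fin m → K) : Fin n → K :=
  fun i => eval v (p i)

/-- The tuple of forms `p` is defined at the point `x` of projective space and sends it to the
point `y`: its value at a vector of homogeneous coordinates of `x` is a nonzero multiple of a vector
of homogeneous coordinates of `y`. For forms `p i` of one common degree
this does not depend on the representatives. -/
def MapsPoint {m n : ℕ} (p : Fin n → MvPolynomial (Fin m) K)
    (x : ℙ K (Fin m → K)) (y : ℙ K (Fin n → K)) : Prop :=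
  ∃ c : K, c ≠ 0 ∧ evalTuple p x.rep = c • y.rep

/-- The set of zeros in the projective plane of a form `E`. -/
def projZeroLocus (E : MvPolynomial (Fin 3) K) : Set (ℙ K (Fin 3 → K)) :=
  {x | eval x.rep E = 0}

/-- The image of the projective line under `φ = (u₁ : u₂ : u₃)`. -/
def paramImage (u : Fin 3 → MvPolynomial (Fin 2) K) : Set (ℙ K (Fin 3 → K)) :=
  {x | ∃ t : ℙ K (Fin 2 → K), MapsPoint u t x}

/-- The tuple has no common factor other than units. -/
def NoCommonFactor {m n : ℕ} (p : Fin n → MvPolynomial (Fin m) K) : Prop :=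
  ∀ q : MvPolynomial (Fin m) K, (∀ i, q ∣ p i) → IsUnit q

/-- `ψ = (F₁ : F₂)` and `φ = (u₁ : u₂ : u₃)` are mutually inverse as rational maps between the
projective line and the image `C` of `φ`: one has `ψ (φ t) = t` for almost all points `t` of the
line, and `φ (ψ x) = x` for almost all points `x` of `C`. Both varieties
are irreducible of dimension one, so "almost all" means "all but finitely many". -/
structure IsInverse (F : Fin 2 → MvPolynomial (Fin 3) K) (u : Fin 3 → MvPolynomial (Fin 2) K) :
    Prop where
  left : ∀ᶠ t : ℙ K (Fin 2 → K) in Filter.cofinite,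
    MapsPoint (fun i => aeval u (F i)) t t
  right : ∀ᶠ x : ℙ K (Fin 3 → K) in Filter.cofinite,
    x ∈ paramImage u → MapsPoint (fun i => aeval F (u i)) x x

/-- The ring `K[T₁, T₂, X₁, X₂, X₃]`; `Sum.inl` indexes the `T`s and `Sum.inr` the `X`s. -/
abbrev TXRing (K : Type*) [Field K] : Type _ := MvPolynomial (Fin 2 ⊕ Fin 3) K

/-- The variable `Tᵢ` has bidegree `(1, 0)` and the variable `Xⱼ` has bidegree `(0, 1)`. -/
def bidegWeight : Fin 2 ⊕ Fin 3 → ℕ × ℕ := Sum.elim (fun _ => (1, 0)) (fun _ => (0, 1))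

/-- The space of bihomogeneous polynomials of bidegree `(i, j)`, with zero. -/
def bihom (K : Type*) [Field K] (i j : ℕ) : Submodule K (TXRing K) :=
  weightedHomogeneousSubmodule K bidegWeight (i, j)

/-- The ideal `I = ⟨u₁, u₂, u₃⟩` of `K[T₁, T₂]`. -/
def paramIdeal (u : Fin 3 → MvPolynomial (Fin 2) K) : Ideal (MvPolynomial (Fin 2) K) :=
  Ideal.span (Set.range u)

theorem monomial_mem_rees (u : Fin 3 → MvPolynomial (Fin 2) K) (j : Fin 3) :
    Polynomial.monomial 1 (u j) ∈ reesAlgebra (paramIdeal u) :=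
  reesAlgebra.monomial_mem.mpr (by
    simpa [paramIdeal] using Ideal.subset_span (Set.mem_range_self j))

/-- The presentation `K[T][X] → Rees(I) = K[T][I Z]`, with `Tᵢ ↦ Tᵢ` and `Xⱼ ↦ uⱼ Z`. -/
def reesMap (u : Fin 3 → MvPolynomial (Fin 2) K) : TXRing K →ₐ[K] reesAlgebra (paramIdeal u) :=
  aeval (Sum.elim
    (fun i => algebraMap (MvPolynomial (Fin 2) K) (reesAlgebra (paramIdeal u)) (X i))
    (fun j => ⟨Polynomial.monomial 1 (u j), monomial_mem_rees u j⟩))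

/-- The moving curve ideal: the defining ideal of the Rees algebra. -/
def movingIdeal (u : Fin 3 → MvPolynomial (Fin 2) K) : Ideal (TXRing K) :=
  RingHom.ker (reesMap u)

/-- The component of bidegree `(i, j)` of an ideal of `K[T, X]`. -/
def bidegPart (J : Ideal (TXRing K)) (i j : ℕ) : Submodule K (TXRing K) :=
  J.restrictScalars K ⊓ bihom K i j

/-- The polynomial `T₁ F₂(X) - T₂ F₁(X)`. -/
def pencil (F : Fin 2 → MvPolynomial (Fin 3) K) : TXRing K :=
  X (Sum.inl 0) * rename Sum.inr (F 1) - X (Sum.inl 1) * rename Sum.inr (F 0)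

/-- The polynomial `P(F₁(X), F₂(X), X)`. -/
def substF (F : Fin 2 → MvPolynomial (Fin 3) K) (P : TXRing K) : MvPolynomial (Fin 3) K :=
  aeval (Sum.elim F X) P

end MovingConic

end

noncomputable section

namespace MovingConic

/-! ### Dimensions of spaces of forms and of bihomogeneous polynomials. -/

section Dimension

variable {K : Type*} [Field K]

/-! Study the linear map `P ↦ P(F₁, F₂, X)` on `𝒦_{k-1,2}`. Since `ψ ∘ φ` is the identity, `Fᵢ(u) =
h Tᵢ` for some `h ≠ 0` (`exists_aeval_eq_X_mul`), so the image of `P` vanishes on `C` and is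
divisible by `E` (`aeval_substF`, `dvd_of_aeval_eq_zero`). The image has degree `2(k-1) + 2 = d`,
and `deg E ≥ d`, so it is a scalar multiple of `E`. The kernel consists of the multiples of the
pencil (`exists_eq_pencil_mul`). The decomposition therefore follows once the map is nonzero.

Nonvanishing is a dimension count (`exists_mem_movingIdeal_substF_ne_zero`): forms of bidegree
`(k-1, 2)` have dimension `6k`, and `P ↦ P(T, u)` sends them to binary forms of degree `5k-1`, of
dimension `5k`. Thus `dim 𝒦_{k-1,2} ≥ k`, while the multiples of the pencil have dimension only
`k-1`.

The bound `deg E ≥ d` (`le_degree_of_aeval_eq_zero`) compares Hilbert functions. Forms of degree `N`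
modulo `E` grow like `(deg E) N`, whereas their values at `u` contain a fixed nonzero multiple of
every binary form of degree `dN` up to a constant. -/

theorem finite_finsupp_degree_eq (m n : ℕ) : {s : Fin m →₀ ℕ | s.degree = n}.Finite := by
  refine ((Finset.univ : Finset (Fin m)).finsuppAntidiag n).finite_toSet.subset fun s hs => ?_
  simpa [Finset.mem_finsuppAntidiag, Finsupp.degree_eq_sum] using hs

theorem natCard_finsupp_degree_eq (m n : ℕ) :
    Nat.card {s : Fin m →₀ ℕ | s.degree = n} = (m + n - 1).choose n := by
  have : {s : Fin m →₀ ℕ | s.degree = n} =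
      ((Finset.univ : Finset (Fin m)).finsuppAntidiag n : Set (Fin m →₀ ℕ)) := by
    ext s
    simp [Finset.mem_finsuppAntidiag, Finsupp.degree_eq_sum]
  rw [this, Nat.card_eq_card_toFinset]
  simp [Finset.card_finsuppAntidiag_nat_eq_choose]

theorem finrank_restrictSupport {σ : Type*} (s : Set (σ →₀ ℕ)) :
    Module.finrank K (restrictSupport K s) = Nat.card s :=
  Module.finrank_eq_nat_card_basis (basisRestrictSupport K s)

theorem homogeneousSubmodule_eq_restrictSupport (m n : ℕ) :
    homogeneousSubmodule (Fin m) K n = restrictSupport K {s | s.degree = n} :=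
  homogeneousSubmodule_eq_finsupp_supported _ _ n

instance finite_homogeneousSubmodule (m n : ℕ) :
    Module.Finite K (homogeneousSubmodule (Fin m) K n) :=
  Module.Finite.iff_fg.mpr (homogeneousSubmodule_fg _ _ n)

theorem finrank_homogeneousSubmodule (m n : ℕ) :
    Module.finrank K (homogeneousSubmodule (Fin m) K n) = (m + n - 1).choose n := by
  rw [homogeneousSubmodule_eq_restrictSupport, finrank_restrictSupport, natCard_finsupp_degree_eq]

theorem finrank_binary (n : ℕ) :
    Module.finrank K (homogeneousSubmodule (Fin 2) K n) = n + 1 := by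
  rw [finrank_homogeneousSubmodule, show 2 + n - 1 = n + 1 by omega, Nat.choose_succ_self_right]

theorem finrank_ternary (n : ℕ) :
    Module.finrank K (homogeneousSubmodule (Fin 3) K n) = (n + 2).choose 2 := by
  rw [finrank_homogeneousSubmodule, show 3 + n - 1 = n + 2 by omega, ← Nat.choose_symm (by omega)]
  congr 1
  omega

theorem weight_bidegWeight (s : Fin 2 ⊕ Fin 3 →₀ ℕ) :
    Finsupp.weight bidegWeight s =
      ((Finsupp.sumFinsuppEquivProdFinsupp s).1.degree,
        (Finsupp.sumFinsuppEquivProdFinsupp s).2.degree) := by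
  rw [Finsupp.weight_apply, Finsupp.sum_fintype _ _ (by simp), Fintype.sum_sum_type]
  simp [bidegWeight, Finsupp.degree_eq_sum, Prod.ext_iff, Prod.fst_sum, Prod.snd_sum]

def bidegExponentsEquiv (i j : ℕ) :
    {s : Fin 2 ⊕ Fin 3 →₀ ℕ | Finsupp.weight bidegWeight s = (i, j)} ≃
      {s : Fin 2 →₀ ℕ | s.degree = i} × {s : Fin 3 →₀ ℕ | s.degree = j} :=
  (Finsupp.sumFinsuppEquivProdFinsupp.subtypeEquiv (q := fun p => p.1.degree = i ∧ p.2.degree = j)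
    fun s => by
      rw [Set.mem_ofPred_eq, weight_bidegWeight, Prod.ext_iff]).trans
    (Equiv.subtypeProdEquivProd (p := fun s : Fin 2 →₀ ℕ => s.degree = i)
      (q := fun s : Fin 3 →₀ ℕ => s.degree = j))

theorem bihom_eq_restrictSupport (i j : ℕ) :
    bihom K i j = restrictSupport K {s | Finsupp.weight bidegWeight s = (i, j)} :=
  weightedHomogeneousSubmodule_eq_finsupp_supported _ _ _

instance finite_bihom (i j : ℕ) : Module.Finite K (bihom K i j) := by
  have := (finite_finsupp_degree_eq 2 i).to_subtype
  have := (finite_finsupp_degree_eq 3 j).to_subtype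
  have := Finite.of_equiv _ (bidegExponentsEquiv i j).symm
  rw [bihom_eq_restrictSupport]
  exact Module.Finite.of_basis (basisRestrictSupport K _)

theorem finrank_bihom (i j : ℕ) :
    Module.finrank K (bihom K i j) = (i + 1) * (j + 2).choose 2 := by
  rw [bihom_eq_restrictSupport, finrank_restrictSupport, Nat.card_congr (bidegExponentsEquiv i j),
    Nat.card_prod, ← finrank_binary (K := K), ← finrank_ternary (K := K),
    homogeneousSubmodule_eq_restrictSupport, homogeneousSubmodule_eq_restrictSupport,
    finrank_restrictSupport, finrank_restrictSupport]

end Dimension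

/-! ### Bihomogeneous polynomials and substitution into them. -/

section Bihomogeneous

variable {K : Type*} [Field K]

theorem mem_bihom {i j : ℕ} {P : TXRing K} :
    P ∈ bihom K i j ↔ IsWeightedHomogeneous bidegWeight P (i, j) := Iff.rfl

theorem bihom_mul {i j i' j' : ℕ} {P P' : TXRing K} (hP : P ∈ bihom K i j)
    (hP' : P' ∈ bihom K i' j') : P * P' ∈ bihom K (i + i') (j + j') :=
  IsWeightedHomogeneous.mul hP hP'

theorem X_inl_mem_bihom (a : Fin 2) : (X (Sum.inl a) : TXRing K) ∈ bihom K 1 0 :=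
  isWeightedHomogeneous_X K bidegWeight (Sum.inl a)

theorem rename_inr_mem_bihom {j : ℕ} {c : MvPolynomial (Fin 3) K} (hc : c.IsHomogeneous j) :
    rename Sum.inr c ∈ bihom K 0 j := by
  rw [mem_bihom, c.as_sum, map_sum]
  refine IsWeightedHomogeneous.sum _ _ _ fun s hs => ?_
  rw [rename_monomial]
  refine isWeightedHomogeneous_monomial _ _ _ ?_
  have hs' : s.degree = j := by
    by_contra h
    exact (mem_support_iff.mp hs) (hc.coeff_eq_zero h)
  rw [Finsupp.weight_apply, Finsupp.sum_mapDomain_index (by simp) (by simp [add_smul]),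
    Finsupp.sum_fintype _ _ (by simp), ← hs', Finsupp.degree_eq_sum]
  simp [bidegWeight, Prod.ext_iff, Prod.fst_sum, Prod.snd_sum]

theorem pencil_mem_bihom {F : Fin 2 → MvPolynomial (Fin 3) K} {j : ℕ}
    (hF : ∀ i, (F i).IsHomogeneous j) : pencil F ∈ bihom K 1 j := by
  have h (a b : Fin 2) : X (Sum.inl a) * rename Sum.inr (F b) ∈ bihom K 1 j := by
    simpa using bihom_mul (X_inl_mem_bihom a) (rename_inr_mem_bihom (hF b))
  exact Submodule.sub_mem _ (h 0 1) (h 1 0)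

theorem monomial_eq_inl_mul_rename_inr (s : Fin 2 ⊕ Fin 3 →₀ ℕ) (r : K) :
    monomial s r = X (Sum.inl 0) ^ s (Sum.inl 0) * X (Sum.inl 1) ^ s (Sum.inl 1) *
      rename Sum.inr (monomial (Finsupp.sumFinsuppEquivProdFinsupp s).2 r) := by
  rw [monomial_eq, monomial_eq, Finsupp.prod_fintype _ _ (by simp),
    Finsupp.prod_fintype _ _ (by simp), Fintype.prod_sum_type, Fin.prod_univ_two]
  simp only [map_mul, map_prod, map_pow, rename_X, rename_C,
    Finsupp.snd_sumFinsuppEquivProdFinsupp]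
  ring

@[elab_as_elim]
theorem bihom_induction {i j : ℕ} {C : TXRing K → Prop} {P : TXRing K} (hP : P ∈ bihom K i j)
    (zero : C 0) (add : ∀ p q, C p → C q → C (p + q))
    (mul : ∀ (a b : ℕ) (c : MvPolynomial (Fin 3) K), a + b = i → c.IsHomogeneous j →
      C (X (Sum.inl 0) ^ a * X (Sum.inl 1) ^ b * rename Sum.inr c)) : C P := by
  rw [P.as_sum]
  refine Finset.sum_induction _ C add zero fun s hs => ?_
  have hw := hP (mem_support_iff.mp hs)
  rw [weight_bidegWeight, Prod.ext_iff] at hw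
  rw [monomial_eq_inl_mul_rename_inr]
  refine mul _ _ _ ?_ (isHomogeneous_monomial _ hw.2)
  simpa [Finsupp.degree_eq_sum] using hw.1

theorem exists_eq_rename_of_mem_bihom_zero {j : ℕ} {P : TXRing K} (hP : P ∈ bihom K 0 j) :
    ∃ c : MvPolynomial (Fin 3) K, c.IsHomogeneous j ∧ P = rename Sum.inr c := by
  refine bihom_induction hP ?_ ?_ ?_
  · exact ⟨0, isHomogeneous_zero _ _ _, by simp⟩
  · intro p q hp hq
    obtain ⟨c, hc, rfl⟩ := hp
    obtain ⟨c', hc', rfl⟩ := hq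
    exact ⟨c + c', hc.add hc', by simp⟩
  · intro a b c hab hc
    obtain ⟨rfl, rfl⟩ : a = 0 ∧ b = 0 := by omega
    exact ⟨c, hc, by simp⟩

theorem exists_eq_add_of_mem_bihom_succ {i j : ℕ} {P : TXRing K} (hP : P ∈ bihom K (i + 1) j) :
    ∃ A ∈ bihom K i j, ∃ c : MvPolynomial (Fin 3) K, c.IsHomogeneous j ∧
      P = X (Sum.inl 0) * A + X (Sum.inl 1) ^ (i + 1) * rename Sum.inr c := by
  refine bihom_induction hP ?_ ?_ ?_
  · exact ⟨0, zero_mem _, 0, isHomogeneous_zero _ _ _, by simp⟩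
  · intro p q hp hq
    obtain ⟨A, hA, c, hc, rfl⟩ := hp
    obtain ⟨A', hA', c', hc', rfl⟩ := hq
    exact ⟨A + A', add_mem hA hA', c + c', hc.add hc', by rw [map_add]; ring⟩
  · intro a b c hab hc
    cases a with
    | zero =>
      obtain rfl : b = i + 1 := by omega
      exact ⟨0, zero_mem _, c, hc, by simp⟩
    | succ a =>
      refine ⟨X (Sum.inl 0) ^ a * X (Sum.inl 1) ^ b * rename Sum.inr c, ?_, 0,
        isHomogeneous_zero _ _ _, by rw [map_zero]; ring⟩
      have h := (((X_inl_mem_bihom (K := K) 0).pow a).mul ((X_inl_mem_bihom 1).pow b)).mul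
        (rename_inr_mem_bihom hc)
      have e : a • ((1, 0) : ℕ × ℕ) + b • (1, 0) + (0, j) = (i, j) := by
        simp
        omega
      rwa [e] at h

theorem aeval_mul_of_isHomogeneous {σ A : Type*} [CommRing A] [Algebra K A] {n : ℕ}
    {p : MvPolynomial σ K} (hp : p.IsHomogeneous n) (b : A) (y : σ → A) :
    aeval (fun l => b * y l) p = b ^ n * aeval y p := by
  rw [p.as_sum, map_sum, map_sum, Finset.mul_sum]
  refine Finset.sum_congr rfl fun s hs => ?_
  have hs' : s.degree = n := by
    by_contra h
    exact (mem_support_iff.mp hs) (hp.coeff_eq_zero h)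
  rw [aeval_monomial, aeval_monomial, Finsupp.prod, Finsupp.prod, ← hs', Finsupp.degree_apply]
  simp only [mul_pow, Finset.prod_mul_distrib, Finset.prod_pow_eq_pow_sum]
  ring

theorem aeval_mul_mul_of_mem_bihom {A : Type*} [CommRing A] [Algebra K A] {i j : ℕ}
    {P : TXRing K} (hP : P ∈ bihom K i j) (a b : A) (x : Fin 2 → A) (y : Fin 3 → A) :
    aeval (Sum.elim (fun l => a * x l) (fun l => b * y l)) P =
      a ^ i * b ^ j * aeval (Sum.elim x y) P := by
  refine bihom_induction hP ?_ ?_ ?_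
  · simp
  · intro p q hp hq
    rw [map_add, hp, hq, map_add, mul_add]
  · intro m n c hmn hc
    subst hmn
    have hr (z : Fin 2 → A) (w : Fin 3 → A) : aeval (Sum.elim z w) (rename Sum.inr c) =
        aeval w c := by
      rw [aeval_rename]; rfl
    simp only [map_mul, map_pow, aeval_X, Sum.elim_inl, hr,
      aeval_mul_of_isHomogeneous hc]
    ring

theorem aeval_isHomogeneous_of_mem_bihom {i j m n : ℕ} {σ : Type*} {P : TXRing K}
    (hP : P ∈ bihom K i j) {x : Fin 2 → MvPolynomial σ K} {y : Fin 3 → MvPolynomial σ K}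
    (hx : ∀ l, (x l).IsHomogeneous m) (hy : ∀ l, (y l).IsHomogeneous n) :
    (aeval (Sum.elim x y) P).IsHomogeneous (m * i + n * j) := by
  refine bihom_induction hP ?_ ?_ ?_
  · simpa using isHomogeneous_zero _ _ _
  · intro p q hp hq
    rw [map_add]; exact hp.add hq
  · intro a b c hab hc
    have hr : aeval (Sum.elim x y) (rename Sum.inr c) = aeval y c := by
      rw [aeval_rename]; rfl
    simp only [map_mul, map_pow, aeval_X, Sum.elim_inl, hr, ← hab, mul_add m]
    exact (((hx 0).pow a).mul ((hx 1).pow b)).mul (hc.aeval y hy)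

end Bihomogeneous

/-! ### Values of forms at projective points. -/

section Evaluation

variable {K : Type*} [Field K]

theorem eval_smul_of_isHomogeneous {σ : Type*} {n : ℕ} {p : MvPolynomial σ K}
    (hp : p.IsHomogeneous n) (c : K) (v : σ → K) : eval (c • v) p = c ^ n * eval v p := by
  have := aeval_mul_of_isHomogeneous hp c v
  rwa [aeval_eq_eval, aeval_eq_eval] at this

theorem evalTuple_smul {m n d : ℕ} {u : Fin n → MvPolynomial (Fin m) K}
    (hu : ∀ i, (u i).IsHomogeneous d) (c : K) (v : Fin m → K) :
    evalTuple u (c • v) = c ^ d • evalTuple u v :=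
  funext fun i => eval_smul_of_isHomogeneous (hu i) c v

theorem eval_aeval {m n : ℕ} (u : Fin n → MvPolynomial (Fin m) K) (p : MvPolynomial (Fin n) K)
    (v : Fin m → K) : eval v (aeval u p) = eval (evalTuple u v) p := by
  rw [← aeval_eq_eval, ← aeval_eq_eval, ← AlgHom.comp_apply, comp_aeval]
  rfl

theorem exists_rep_eq_smul {n : ℕ} {v : Fin n → K} (hv : v ≠ 0) :
    ∃ a : K, a ≠ 0 ∧ (Projectivization.mk K v hv).rep = a • v := by
  obtain ⟨a, ha⟩ := Projectivization.exists_smul_eq_mk_rep K v hv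
  exact ⟨a, a.ne_zero, ha.symm⟩

theorem mapsPoint_mk {m n d : ℕ} {u : Fin n → MvPolynomial (Fin m) K}
    (hu : ∀ i, (u i).IsHomogeneous d) {v : Fin m → K} (hv : v ≠ 0) (huv : evalTuple u v ≠ 0) :
    MapsPoint u (Projectivization.mk K v hv) (Projectivization.mk K (evalTuple u v) huv) := by
  obtain ⟨a, ha, hav⟩ := exists_rep_eq_smul hv
  obtain ⟨b, hb, hbv⟩ := exists_rep_eq_smul huv
  refine ⟨a ^ d * b⁻¹, by positivity, ?_⟩
  rw [hav, hbv, evalTuple_smul hu, smul_smul, inv_mul_cancel_right₀ hb]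

theorem evalTuple_zero {m n d : ℕ} (hd : d ≠ 0) {u : Fin n → MvPolynomial (Fin m) K}
    (hu : ∀ i, (u i).IsHomogeneous d) : evalTuple u 0 = 0 := by
  have := evalTuple_smul hu 0 0
  rwa [zero_pow hd, zero_smul, zero_smul] at this

theorem vec_one_ne_zero (s : K) : ![1, s] ≠ 0 := fun h => one_ne_zero (congrFun h 0)

theorem affinePoint_injective :
    Function.Injective fun s : K => Projectivization.mk K ![1, s] (vec_one_ne_zero s) := by
  intro s s' hs
  obtain ⟨a, ha⟩ :=
    (Projectivization.mk_eq_mk_iff' K _ _ (vec_one_ne_zero s) (vec_one_ne_zero s')).mp hs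
  have h0 := congrFun ha 0
  have h1 := congrFun ha 1
  simp at h0 h1
  simpa [h0] using h1.symm

instance infinite_projectiveLine [Infinite K] : Infinite (ℙ K (Fin 2 → K)) :=
  Infinite.of_injective _ affinePoint_injective

theorem eq_zero_of_eventually_eval_rep_eq_zero [Infinite K] {n : ℕ} {g : MvPolynomial (Fin 2) K}
    (hg : g.IsHomogeneous n)
    (h : ∀ᶠ t : ℙ K (Fin 2 → K) in Filter.cofinite, eval t.rep g = 0) : g = 0 := by
  have hev : ∀ᶠ s : K in Filter.cofinite, eval ![1, s] g = 0 := by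
    filter_upwards [affinePoint_injective.tendsto_cofinite.eventually h] with s hs
    obtain ⟨a, ha, hav⟩ := exists_rep_eq_smul (vec_one_ne_zero s)
    rw [hav, eval_smul_of_isHomogeneous hg] at hs
    exact (mul_eq_zero.mp hs).resolve_left (pow_ne_zero _ ha)
  let G : Polynomial K := aeval ![1, Polynomial.X] g
  have hG (s : K) : G.eval s = eval ![1, s] g := by
    have : Polynomial.aeval s G = aeval ![1, s] g := by
      rw [← AlgHom.comp_apply, comp_aeval]
      congr 2
      ext i
      fin_cases i <;> simp
    simpa [Polynomial.coe_aeval_eq_eval, aeval_eq_eval] using this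
  have hG0 : G = 0 := by
    refine Polynomial.eq_zero_of_infinite_isRoot G ?_
    have : {s | G.IsRoot s} = {s | ¬ eval ![1, s] g = 0}ᶜ := by
      ext s
      simp [Polynomial.IsRoot, hG]
    rw [this]
    exact (Filter.eventually_cofinite.mp hev).infinite_compl
  -- The dehomogenization `G` controls `g` only off the point `v 0 = 0`; the factor `X 0` takes care
  -- of that point.
  have hX : X 0 * g = 0 := by
    refine MvPolynomial.funext fun v => ?_
    rw [map_mul, eval_X, map_zero]
    by_cases hv : v 0 = 0
    · rw [hv, zero_mul]
    · have : v = v 0 • ![1, v 1 / v 0] := by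
        ext i
        fin_cases i
        · simp
        · simp [mul_div_cancel₀ _ hv]
      rw [this, eval_smul_of_isHomogeneous hg, ← hG, hG0]
      simp
  exact (mul_eq_zero.mp hX).resolve_left (X_ne_zero 0)

end Evaluation

/-! ### The relation `Fᵢ(u) = h Tᵢ`. -/

section Inverse

variable {K : Type*} [Field K]

theorem exists_aeval_eq_X_mul [Infinite K] {d : ℕ} {u : Fin 3 → MvPolynomial (Fin 2) K}
    (hu : ∀ i, (u i).IsHomogeneous d) {F : Fin 2 → MvPolynomial (Fin 3) K}
    (hF : ∀ i, (F i).IsHomogeneous 2) (hinv : IsInverse F u) :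
    ∃ h : MvPolynomial (Fin 2) K, h ≠ 0 ∧ ∀ i, aeval u (F i) = h * X i := by
  have hhom (i j : Fin 2) : (X i * aeval u (F j)).IsHomogeneous (1 + d * 2) :=
    (isHomogeneous_X K i).mul ((hF j).aeval u hu)
  have hcross : X 0 * aeval u (F 1) - X 1 * aeval u (F 0) = 0 := by
    refine eq_zero_of_eventually_eval_rep_eq_zero ((hhom 0 1).sub (hhom 1 0)) ?_
    filter_upwards [hinv.left] with t ht
    obtain ⟨c, -, hct⟩ := ht
    have h0 : eval t.rep (aeval u (F 0)) = c * t.rep 0 := congrFun hct 0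
    have h1 : eval t.rep (aeval u (F 1)) = c * t.rep 1 := congrFun hct 1
    rw [map_sub, map_mul, map_mul, eval_X, eval_X, h0, h1]
    ring
  have hdvd : X 0 ∣ X 1 * aeval u (F 0) := ⟨_, (sub_eq_zero.mp hcross).symm⟩
  have hX : Prime (X 0 : MvPolynomial (Fin 2) K) := X_prime
  obtain ⟨h, hh⟩ := (hX.dvd_or_dvd hdvd).resolve_left (by simp [X_dvd_X])
  have hh1 : aeval u (F 1) = X 1 * h := by
    refine mul_left_cancel₀ (X_ne_zero (R := K) (0 : Fin 2)) ?_
    rw [sub_eq_zero.mp hcross, hh]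
    ring
  have hi : ∀ i, aeval u (F i) = h * X i := by
    rw [Fin.forall_fin_two, hh, hh1]
    exact ⟨mul_comm _ _, mul_comm _ _⟩
  refine ⟨h, ?_, hi⟩
  -- If `h` were zero, `ψ ∘ φ` would be defined nowhere.
  rintro rfl
  obtain ⟨t, c, hc, ht⟩ := hinv.left.exists
  refine smul_ne_zero hc t.rep_nonzero (ht.symm.trans (funext fun i => ?_))
  change eval t.rep (aeval u (F i)) = 0
  rw [hi, zero_mul, map_zero]

end Inverse

/-! ### The kernel of the substitution `T ↦ F(X)`. -/

section Pencil

variable {K : Type*} [Field K]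

theorem substF_pencil (F : Fin 2 → MvPolynomial (Fin 3) K) : substF F (pencil F) = 0 := by
  have hr (c : MvPolynomial (Fin 3) K) : aeval (Sum.elim F X) (rename Sum.inr c) = c := by
    rw [aeval_rename]
    exact aeval_X_left_apply c
  simp only [substF, pencil, map_sub, map_mul, aeval_X, Sum.elim_inl, hr]
  ring

theorem ne_zero_of_noCommonFactor {F : Fin 2 → MvPolynomial (Fin 3) K}
    (hF : ∀ i, (F i).IsHomogeneous 2) (hF_coprime : NoCommonFactor F) : F 0 ≠ 0 := by
  intro h0
  have h1 : IsUnit (F 1) := hF_coprime _ (Fin.forall_fin_two.mpr ⟨h0 ▸ dvd_zero _, dvd_rfl⟩)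
  have := (hF 1).totalDegree h1.ne_zero
  rw [(isUnit_iff_totalDegree_of_isReduced.mp h1).2] at this
  omega

theorem exists_eq_C_of_mul_isHomogeneous {σ : Type*} {n m : ℕ} (hnm : n ≤ m)
    {p q : MvPolynomial σ K} (hp : p.IsHomogeneous m) (hpq : (p * q).IsHomogeneous n)
    (hp0 : p ≠ 0) : ∃ r : K, q = C r := by
  by_cases hq : q = 0
  · exact ⟨0, by simp [hq]⟩
  have h := hpq.totalDegree (mul_ne_zero hp0 hq)
  rw [totalDegree_mul_of_isDomain hp0 hq, hp.totalDegree hp0] at h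
  exact ⟨_, totalDegree_eq_zero_iff_eq_C.mp (by omega)⟩

/-- Induction on the `T`-degree, using that `F₁` and `F₂` are coprime of the same degree as `P` has
in `X`. The clause for `i = 0` is needed because `i - 1` truncates, so that `bihom K (i - 1) 0`
contains the constants there. -/
theorem exists_eq_pencil_mul {F : Fin 2 → MvPolynomial (Fin 3) K}
    (hF : ∀ i, (F i).IsHomogeneous 2) (hF_coprime : NoCommonFactor F) {i : ℕ} {P : TXRing K}
    (hP : P ∈ bihom K i 2) (h : substF F P = 0) :
    ∃ g ∈ bihom K (i - 1) 0, P = pencil F * g ∧ (i = 0 → g = 0) := by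
  have hr (c : MvPolynomial (Fin 3) K) : substF F (rename Sum.inr c) = c := by
    rw [substF, aeval_rename]
    exact aeval_X_left_apply c
  have hF0 := ne_zero_of_noCommonFactor hF hF_coprime
  have hrel : IsRelPrime (F 0) (F 1) := fun q h0 h1 =>
    hF_coprime q (Fin.forall_fin_two.mpr ⟨h0, h1⟩)
  induction i generalizing P with
  | zero =>
    obtain ⟨c, -, rfl⟩ := exists_eq_rename_of_mem_bihom_zero hP
    rw [hr] at h
    exact ⟨0, zero_mem _, by simp [h], fun _ => rfl⟩
  | succ i ih =>
    obtain ⟨A, hA, c, hc, rfl⟩ := exists_eq_add_of_mem_bihom_succ hP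
    have h' : F 0 * substF F A + F 1 ^ (i + 1) * c = 0 := by
      rw [← h]
      conv_rhs => rw [substF, map_add, map_mul, map_mul, map_pow, aeval_X, aeval_X]
      change _ = F 0 * substF F A + F 1 ^ (i + 1) * substF F (rename Sum.inr c)
      rw [hr]
    have hdvd : F 0 ∣ F 1 ^ (i + 1) * c :=
      ⟨-substF F A, by linear_combination h'⟩
    -- Coprimality gives `F₁ ∣ c`, and both have degree 2, so `c = r F₁` with `r` constant. Then `P
    -- = T₁ (A + r T₂ⁱ F₂) - r T₂ⁱ (T₁F₂ - T₂F₁)`, and induction applies to the bracket after `T₁`.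
    obtain ⟨c', rfl⟩ := hrel.pow_right.dvd_of_dvd_mul_left hdvd
    obtain ⟨r, rfl⟩ := exists_eq_C_of_mul_isHomogeneous le_rfl (hF 0) hc hF0
    have hTr : C r * X (Sum.inl 1) ^ i ∈ bihom K i 0 := by
      have := ((isWeightedHomogeneous_C bidegWeight r).mul ((X_inl_mem_bihom (K := K) 1).pow i))
      have e : (0 : ℕ × ℕ) + i • (1, 0) = (i, 0) := by simp
      rwa [e] at this
    have hA' : A + C r * X (Sum.inl 1) ^ i * rename Sum.inr (F 1) ∈ bihom K i 2 :=
      add_mem hA (by simpa using bihom_mul hTr (rename_inr_mem_bihom (hF 1)))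
    obtain ⟨g, hg, hgA, hg0⟩ := ih hA' (by
      refine (mul_eq_zero.mp ?_).resolve_left hF0
      have : substF F (A + C r * X (Sum.inl 1) ^ i * rename Sum.inr (F 1)) =
          substF F A + C r * F 1 ^ i * F 1 := by
        nth_rewrite 3 [← hr (F 1)]
        simp [substF, algebraMap_eq]
      rw [this]
      linear_combination h')
    refine ⟨X (Sum.inl 0) * g - C r * X (Sum.inl 1) ^ i, ?_, ?_, by simp⟩
    · refine Submodule.sub_mem _ ?_ hTr
      cases i with
      | zero => simp [hg0]
      | succ i => simpa [add_comm] using bihom_mul (X_inl_mem_bihom 0) hg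
    · rw [mul_sub, mul_left_comm, ← hgA, map_mul, rename_C, pencil]
      ring

end Pencil

/-! ### Membership in the moving curve ideal. -/

section MovingIdeal

variable {K : Type*} [Field K]

/-- Homogeneity in `X` makes the image in the Rees algebra equal to `P(T, u) Zʲ`. -/
theorem mem_movingIdeal_iff {u : Fin 3 → MvPolynomial (Fin 2) K} {i j : ℕ} {P : TXRing K}
    (hP : P ∈ bihom K i j) : P ∈ movingIdeal u ↔ aeval (Sum.elim X u) P = 0 := by
  have key : ((reesMap u P : reesAlgebra (paramIdeal u)) : Polynomial (MvPolynomial (Fin 2) K)) =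
      Polynomial.X ^ j * Polynomial.C (aeval (Sum.elim X u) P) := by
    have h1 : ((reesMap u P : reesAlgebra (paramIdeal u)) :
        Polynomial (MvPolynomial (Fin 2) K)) =
        aeval (Sum.elim (fun l => 1 * Polynomial.C (X l))
          (fun l => Polynomial.X * Polynomial.C (u l))) P := by
      change ((reesAlgebra (paramIdeal u)).val.restrictScalars K).comp (reesMap u) P = _
      congr 1
      refine MvPolynomial.algHom_ext fun l => ?_
      rcases l with l | l
      · simp [reesMap]
      · simp [reesMap, ← Polynomial.C_mul_X_eq_monomial]
    have h2 : Polynomial.C (aeval (Sum.elim X u) P) =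
        aeval (Sum.elim (fun l => Polynomial.C (X l)) (fun l => Polynomial.C (u l))) P := by
      change ((Algebra.ofId (MvPolynomial (Fin 2) K)
        (Polynomial (MvPolynomial (Fin 2) K))).restrictScalars K).comp
          (aeval (Sum.elim X u)) P = _
      congr 1
      refine MvPolynomial.algHom_ext fun l => ?_
      rcases l with l | l <;> simp [Algebra.ofId_apply]
    rw [h1, h2, aeval_mul_mul_of_mem_bihom hP, one_pow, one_mul]
  rw [movingIdeal, RingHom.mem_ker, ← Subtype.coe_inj, key]
  simp

theorem pencil_mem_movingIdeal {u : Fin 3 → MvPolynomial (Fin 2) K}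
    {F : Fin 2 → MvPolynomial (Fin 3) K} (hF : ∀ i, (F i).IsHomogeneous 2)
    {h : MvPolynomial (Fin 2) K} (hFu : ∀ i, aeval u (F i) = h * X i) :
    pencil F ∈ movingIdeal u := by
  have hr (c : MvPolynomial (Fin 3) K) : aeval (Sum.elim X u) (rename Sum.inr c) = aeval u c := by
    rw [aeval_rename]; rfl
  rw [mem_movingIdeal_iff (pencil_mem_bihom hF), pencil, map_sub, map_mul, map_mul, aeval_X,
    aeval_X, hr, hr, hFu, hFu]
  simp only [Sum.elim_inl]
  ring

theorem aeval_substF {u : Fin 3 → MvPolynomial (Fin 2) K}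
    {F : Fin 2 → MvPolynomial (Fin 3) K}
    {h : MvPolynomial (Fin 2) K} (hFu : ∀ i, aeval u (F i) = h * X i) {i j : ℕ} {P : TXRing K}
    (hP : P ∈ bihom K i j) :
    aeval u (substF F P) = h ^ i * aeval (Sum.elim X u) P := by
  have := aeval_mul_mul_of_mem_bihom hP h 1 X u
  rw [one_pow, mul_one] at this
  rw [← this, substF, ← AlgHom.comp_apply, comp_aeval]
  congr 2
  ext1 l
  rcases l with l | l
  · exact hFu l
  · simp

end MovingIdeal

/-! ### Absence of base points, and binary forms in the ideal of `u`. -/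

section BasePoints

variable {K : Type*} [Field K]

/-- Modulo the linear form, `Xᵢ ≡ (Xⱼ / vⱼ) vᵢ` for any `j` with `vⱼ ≠ 0`, so `p ≡ (Xⱼ / vⱼ)ⁿ p(v) =
0`. -/
theorem linearForm_dvd {n : ℕ} {p : MvPolynomial (Fin 2) K} (hp : p.IsHomogeneous n)
    {v : Fin 2 → K} (hv : v ≠ 0) (hpv : eval v p = 0) :
    C (v 1) * X 0 - C (v 0) * X 1 ∣ p := by
  set ℓ : MvPolynomial (Fin 2) K := C (v 1) * X 0 - C (v 0) * X 1 with hℓ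
  obtain ⟨j, hj⟩ := Function.ne_iff.mp hv
  rw [Pi.zero_apply] at hj
  have hcc : (C (v j) * C (v j)⁻¹ : MvPolynomial (Fin 2) K) = 1 := by
    rw [← C_mul, mul_inv_cancel₀ hj, C_1]
  let y : Fin 2 → MvPolynomial (Fin 2) K := fun i => (C (v j)⁻¹ * X j) * C (v i)
  have hy : aeval y p = 0 := by
    have h1 : aeval (fun i => (C (v i) : MvPolynomial (Fin 2) K)) p = C (eval v p) := by
      rw [← aeval_eq_eval]
      change _ = (Algebra.ofId K (MvPolynomial (Fin 2) K)).comp (aeval v) p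
      congr 1
      ext1 i
      simp [Algebra.ofId_apply, algebraMap_eq]
    rw [aeval_mul_of_isHomogeneous hp, h1, hpv, C_0, mul_zero]
  have hXy (i : Fin 2) : Ideal.Quotient.mk (Ideal.span {ℓ}) (X i) =
      Ideal.Quotient.mk (Ideal.span {ℓ}) (y i) := by
    rw [Ideal.Quotient.eq, Ideal.mem_span_singleton]
    have hself : X j - y j = 0 := by
      simp only [y]
      linear_combination (-X j) * hcc
    fin_cases j <;> fin_cases i <;> simp only [Fin.zero_eta, Fin.mk_one, Fin.isValue] at *
    · rw [hself]; exact dvd_zero _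
    · refine ⟨-C (v 0)⁻¹, ?_⟩
      simp only [y, hℓ, Fin.zero_eta, Fin.isValue]
      linear_combination (-X 1) * hcc
    · refine ⟨C (v 1)⁻¹, ?_⟩
      simp only [y, hℓ, Fin.mk_one, Fin.isValue]
      linear_combination (-X 0) * hcc
    · rw [hself]; exact dvd_zero _
  rw [← Ideal.mem_span_singleton, ← Ideal.Quotient.eq_zero_iff_mem]
  have : (Ideal.Quotient.mkₐ K (Ideal.span {ℓ})) p =
      ((Ideal.Quotient.mkₐ K (Ideal.span {ℓ})).comp (aeval y)) p := by
    congr 1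
    ext1 i
    simpa using hXy i
  rw [AlgHom.comp_apply, hy, map_zero] at this
  exact this

theorem evalTuple_ne_zero {d : ℕ} {u : Fin 3 → MvPolynomial (Fin 2) K}
    (hu : ∀ i, (u i).IsHomogeneous d) (hu_coprime : NoCommonFactor u)
    {v : Fin 2 → K} (hv : v ≠ 0) : evalTuple u v ≠ 0 := by
  intro h
  have hunit := hu_coprime _ fun i => linearForm_dvd (hu i) hv (congrFun h i)
  have := hunit.map (eval v)
  simp [mul_comm] at this

attribute [local instance] MvPolynomial.gradedAlgebra in
theorem exists_isHomogeneous_sum_of_mem_span {d m : ℕ} {u : Fin 3 → MvPolynomial (Fin 2) K}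
    (hu : ∀ i, (u i).IsHomogeneous d) {p : MvPolynomial (Fin 2) K}
    (hp : p.IsHomogeneous (m + d)) (hmem : p ∈ Ideal.span (Set.range u)) :
    ∃ q : Fin 3 → MvPolynomial (Fin 2) K, (∀ i, (q i).IsHomogeneous m) ∧
      p = ∑ i, q i * u i := by
  obtain ⟨c, hc⟩ := (Ideal.mem_span_range_iff_exists_fun).mp hmem
  refine ⟨fun i => homogeneousComponent m (c i), fun i => homogeneousComponent_isHomogeneous _ _, ?_⟩
  rw [← homogeneousComponent_eq_self hp, ← hc, map_sum]
  refine Finset.sum_congr rfl fun i _ => ?_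
  have := DirectSum.coe_decompose_mul_of_right_mem_of_le (homogeneousSubmodule (Fin 2) K)
    (a := c i) (hu i) (Nat.le_add_left d m)
  have hdec (f : MvPolynomial (Fin 2) K) (n : ℕ) :
      (DirectSum.decompose (homogeneousSubmodule (Fin 2) K) f n : MvPolynomial (Fin 2) K) =
        homogeneousComponent n f := decomposition.decompose'_apply f n
  rwa [Nat.add_sub_cancel, hdec, hdec] at this

/-- The `uᵢ` have no common zero but possibly the origin, so by the Nullstellensatz `T₁ᵃ` and `T₂ᵇ`
lie in the ideal; every monomial of degree at least `a + b` is divisible by one of them. -/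
theorem exists_forall_isHomogeneous_mem_span [IsAlgClosed K] {d : ℕ}
    {u : Fin 3 → MvPolynomial (Fin 2) K}
    (hu : ∀ i, (u i).IsHomogeneous d) (hu_coprime : NoCommonFactor u) :
    ∃ N : ℕ, ∀ n ≥ N, ∀ p : MvPolynomial (Fin 2) K, p.IsHomogeneous n →
      p ∈ Ideal.span (Set.range u) := by
  set I := Ideal.span (Set.range u)
  have hX (i : Fin 2) : X i ∈ I.radical := by
    rw [← vanishingIdeal_zeroLocus_eq_radical (K := K)]
    rw [mem_vanishingIdeal_iff]
    intro v hv
    have : v = 0 := by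
      by_contra h
      refine evalTuple_ne_zero hu hu_coprime h (funext fun i => ?_)
      have := hv (u i) (Ideal.subset_span (Set.mem_range_self i))
      rwa [aeval_eq_eval] at this
    simp [this]
  obtain ⟨a, ha⟩ := hX 0
  obtain ⟨b, hb⟩ := hX 1
  refine ⟨a + b, fun n hn p hp => ?_⟩
  rw [p.as_sum]
  refine I.sum_mem fun s hs => ?_
  have hs' : s 0 + s 1 = n := by
    by_contra h
    refine (mem_support_iff.mp hs) (hp.coeff_eq_zero ?_)
    rwa [Finsupp.degree_eq_sum, Fin.sum_univ_two]
  rw [monomial_eq, Finsupp.prod_fintype _ _ (by simp), Fin.prod_univ_two]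
  refine I.mul_mem_left _ ?_
  by_cases h : a ≤ s 0
  · exact I.mul_mem_right _ (I.mem_of_dvd (pow_dvd_pow _ h) ha)
  · exact I.mul_mem_left _ (I.mem_of_dvd (pow_dvd_pow _ (by omega)) hb)

end BasePoints

/-! ### The implicit equation: divisibility and the bound on its degree. -/

section ImplicitEquation

variable {K : Type*} [Field K]

theorem aeval_eq_zero_of_projZeroLocus_eq [Infinite K] {d e : ℕ} (hd : d ≠ 0)
    {u : Fin 3 → MvPolynomial (Fin 2) K}
    (hu : ∀ i, (u i).IsHomogeneous d) {E : MvPolynomial (Fin 3) K} (hE : E.IsHomogeneous e)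
    (hE_irred : Irreducible E) (hE_curve : projZeroLocus E = paramImage u) :
    aeval u E = 0 := by
  have he : e ≠ 0 := by
    rintro rfl
    refine hE_irred.not_isUnit (isUnit_iff_totalDegree_of_isReduced.mpr ⟨?_, ?_⟩)
    · have h := totalDegree_eq_zero_iff_eq_C.mp (hE.totalDegree hE_irred.ne_zero)
      rw [isUnit_iff_ne_zero]
      intro h0
      rw [h0, C_0] at h
      exact hE_irred.ne_zero h
    · exact hE.totalDegree hE_irred.ne_zero
  refine MvPolynomial.funext fun v => ?_
  rw [eval_aeval, map_zero]
  by_cases huv : evalTuple u v = 0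
  · have := eval_smul_of_isHomogeneous hE 0 0
    rwa [zero_pow he, zero_mul, zero_smul, ← huv] at this
  have hv : v ≠ 0 := by
    rintro rfl
    exact huv (evalTuple_zero hd hu)
  have hx : Projectivization.mk K _ huv ∈ projZeroLocus E := by
    rw [hE_curve]
    exact ⟨_, mapsPoint_mk hu hv huv⟩
  obtain ⟨a, ha, hav⟩ := exists_rep_eq_smul huv
  change eval _ E = 0 at hx
  rw [hav, eval_smul_of_isHomogeneous hE] at hx
  exact (mul_eq_zero.mp hx).resolve_left (pow_ne_zero _ ha)

/-- By the Nullstellensatz for the prime ideal `⟨E⟩` it suffices that `p` vanishes at the zeros of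
`E`, and these are, up to scaling, values of `u`. -/
theorem dvd_of_aeval_eq_zero [IsAlgClosed K] {d e n : ℕ} (hd : d ≠ 0)
    {u : Fin 3 → MvPolynomial (Fin 2) K}
    (hu : ∀ i, (u i).IsHomogeneous d) {E : MvPolynomial (Fin 3) K} (hE : E.IsHomogeneous e)
    (hE_irred : Irreducible E) (hE_curve : projZeroLocus E = paramImage u)
    {p : MvPolynomial (Fin 3) K} (hp : p.IsHomogeneous n) (hpu : aeval u p = 0) : E ∣ p := by
  have hprime : (Ideal.span {E}).IsPrime :=
    (Ideal.span_singleton_prime hE_irred.ne_zero).mpr hE_irred.prime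
  rw [← Ideal.mem_span_singleton, ← hprime.radical,
    ← vanishingIdeal_zeroLocus_eq_radical (K := K), mem_vanishingIdeal_iff]
  intro v hv
  have hEv : eval v E = 0 := by
    have := hv E (Ideal.mem_span_singleton_self E)
    rwa [aeval_eq_eval] at this
  have hpt (w : Fin 2 → K) : eval (evalTuple u w) p = 0 := by
    rw [← eval_aeval, hpu, map_zero]
  rw [aeval_eq_eval]
  by_cases hv0 : v = 0
  · rw [hv0, ← evalTuple_zero hd hu]
    exact hpt 0
  obtain ⟨a, ha, hav⟩ := exists_rep_eq_smul hv0
  have hx : Projectivization.mk K v hv0 ∈ paramImage u := by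
    rw [← hE_curve]
    change eval _ E = 0
    rw [hav, eval_smul_of_isHomogeneous hE, hEv, mul_zero]
  obtain ⟨t, c, hc, ht⟩ := hx
  have := hpt t.rep
  rw [ht, hav, smul_smul, eval_smul_of_isHomogeneous hp] at this
  exact (mul_eq_zero.mp this).resolve_left (pow_ne_zero _ (mul_ne_zero hc ha))

/-- For `n = 0` take `q = p(F)`, as `p(h T) = hᵐ p`. Each further `d` degrees are absorbed by
writing `p = ∑ qᵢ uᵢ` and replacing `uᵢ` by `Xᵢ`; the power of `h` thus stays fixed as `n` grows. -/
theorem exists_aeval_eq_pow_mul {d m : ℕ} {u : Fin 3 → MvPolynomial (Fin 2) K}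
    {F : Fin 2 → MvPolynomial (Fin 3) K} (hF : ∀ i, (F i).IsHomogeneous 2)
    {h : MvPolynomial (Fin 2) K} (hFu : ∀ i, aeval u (F i) = h * X i)
    (hm : ∀ n ≥ m, ∀ p : MvPolynomial (Fin 2) K, p.IsHomogeneous (n + d) →
      ∃ q : Fin 3 → MvPolynomial (Fin 2) K, (∀ i, (q i).IsHomogeneous n) ∧ p = ∑ i, q i * u i)
    (n : ℕ) {p : MvPolynomial (Fin 2) K} (hp : p.IsHomogeneous (m + n * d)) :
    ∃ q : MvPolynomial (Fin 3) K, q.IsHomogeneous (2 * m + n) ∧ aeval u q = h ^ m * p := by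
  induction n generalizing p with
  | zero =>
    rw [zero_mul, add_zero] at hp
    refine ⟨aeval F p, hp.aeval F hF, ?_⟩
    rw [← AlgHom.comp_apply, comp_aeval]
    simp only [hFu]
    rw [aeval_mul_of_isHomogeneous hp, aeval_X_left_apply]
  | succ n ih =>
    obtain ⟨q, hq, rfl⟩ := hm (m + n * d) (Nat.le_add_right _ _) p (by convert hp using 1; ring)
    choose r hr hru using fun i => ih (hq i)
    refine ⟨∑ i, r i * X i, IsHomogeneous.sum _ _ _ fun i _ => (hr i).mul (isHomogeneous_X K i),
      ?_⟩
    rw [map_sum, Finset.mul_sum]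
    refine Finset.sum_congr rfl fun i _ => ?_
    rw [map_mul, aeval_X, hru, mul_assoc]

/-- Rank-nullity for `q ↦ q(u)` in degree `N`: the range contains `f` times all binary forms of
degree `d`, and the kernel contains all multiples of `E`. -/
theorem hilbert_function_le {d e m N : ℕ} {u : Fin 3 → MvPolynomial (Fin 2) K}
    {E : MvPolynomial (Fin 3) K} (hE : E.IsHomogeneous e) (hE0 : E ≠ 0) (hEu : aeval u E = 0)
    {f : MvPolynomial (Fin 2) K} (hf : f ≠ 0)
    (hrange : ∀ p : MvPolynomial (Fin 2) K, p.IsHomogeneous d →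
      ∃ q : MvPolynomial (Fin 3) K, q.IsHomogeneous N ∧ aeval u q = f * p)
    (hN : m + e = N) : d + 1 + (m + 2).choose 2 ≤ (N + 2).choose 2 := by
  let S : homogeneousSubmodule (Fin 3) K N →ₗ[K] MvPolynomial (Fin 2) K :=
    (aeval u).toLinearMap ∘ₗ Submodule.subtype _
  have h1 : d + 1 ≤ Module.finrank K (LinearMap.range S) := by
    rw [← finrank_binary (K := K) d]
    let R : homogeneousSubmodule (Fin 2) K d →ₗ[K] LinearMap.range S :=
      (LinearMap.mulLeft K f ∘ₗ Submodule.subtype _).codRestrict _ fun p => by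
        obtain ⟨q, hq, hqp⟩ := hrange p p.2
        exact ⟨⟨q, hq⟩, hqp⟩
    refine LinearMap.finrank_le_finrank_of_injective (f := R) fun p p' hpp' => ?_
    exact Subtype.ext (mul_left_cancel₀ hf (congrArg Subtype.val hpp'))
  have h2 : (m + 2).choose 2 ≤ Module.finrank K (LinearMap.ker S) := by
    rw [← finrank_ternary (K := K) m]
    let M : homogeneousSubmodule (Fin 3) K m →ₗ[K] homogeneousSubmodule (Fin 3) K N :=
      (LinearMap.mulRight K E ∘ₗ Submodule.subtype _).codRestrict _ fun p => by
        rw [← hN]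
        exact IsHomogeneous.mul p.2 hE
    let R : homogeneousSubmodule (Fin 3) K m →ₗ[K] LinearMap.ker S := M.codRestrict _ fun p => by
      change aeval u (p.1 * E) = 0
      rw [map_mul, hEu, mul_zero]
    refine LinearMap.finrank_le_finrank_of_injective (f := R) fun p p' hpp' => ?_
    exact Subtype.ext (mul_right_cancel₀ hE0
      (congrArg (fun q => (q : homogeneousSubmodule (Fin 3) K N).1) (congrArg Subtype.val hpp')))
  have h3 := S.finrank_range_add_finrank_ker
  rw [finrank_ternary] at h3
  omega

theorem two_mul_choose_two (n : ℕ) : 2 * (n + 2).choose 2 = (n + 2) * (n + 1) := by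
  rw [Nat.choose_two_right, Nat.mul_div_cancel' (Nat.even_mul_pred_self _).two_dvd]
  rfl

theorem le_of_forall_choose_le {d e m : ℕ}
    (h : ∀ n ≥ e, m + n * d + 1 + (2 * m + n - e + 2).choose 2 ≤ (2 * m + n + 2).choose 2) :
    d ≤ e := by
  by_contra! hlt
  obtain ⟨c, rfl⟩ := Nat.exists_eq_add_of_lt hlt
  -- With `n = e + x` and `d ≥ e + 1`, the terms `e x` cancel and `x` remains on the left; this `x`
  -- exceeds what remains on the right, about `e (2m + 2) + e (e - 1) / 2`.
  have h1 := h (e + e * (2 * m + e + 3)) (Nat.le_add_right _ _)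
  have h2 := two_mul_choose_two (2 * m + (e + e * (2 * m + e + 3)))
  have h3 := two_mul_choose_two (2 * m + e * (2 * m + e + 3))
  rw [show 2 * m + (e + e * (2 * m + e + 3)) - e = 2 * m + e * (2 * m + e + 3) by omega] at h1
  set x := e * (2 * m + e + 3)
  have hx : x = e * (2 * m + e + 3) := rfl
  clear_value x
  nlinarith [Nat.zero_le ((e + x) * c)]

theorem le_degree_of_aeval_eq_zero [IsAlgClosed K] {d e : ℕ}
    {u : Fin 3 → MvPolynomial (Fin 2) K}
    (hu : ∀ i, (u i).IsHomogeneous d) (hu_coprime : NoCommonFactor u)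
    {F : Fin 2 → MvPolynomial (Fin 3) K} (hF : ∀ i, (F i).IsHomogeneous 2)
    {h : MvPolynomial (Fin 2) K} (h0 : h ≠ 0) (hFu : ∀ i, aeval u (F i) = h * X i)
    {E : MvPolynomial (Fin 3) K} (hE : E.IsHomogeneous e) (hE0 : E ≠ 0) (hEu : aeval u E = 0) :
    d ≤ e := by
  obtain ⟨m, hm⟩ := exists_forall_isHomogeneous_mem_span hu hu_coprime
  refine le_of_forall_choose_le (m := m) fun n hn => ?_
  refine hilbert_function_le hE hE0 hEu (pow_ne_zero m h0) (fun p hp => ?_) (by omega)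
  refine exists_aeval_eq_pow_mul hF hFu (fun n' hn' p hp => ?_) n hp
  exact exists_isHomogeneous_sum_of_mem_span hu hp (hm _ (by omega) p hp)

end ImplicitEquation

/-! ### A moving conic that is not a multiple of the pencil. -/

section Existence

variable {K : Type*} [Field K]

theorem exists_mem_movingIdeal_substF_ne_zero {k : ℕ} (hk : 1 < k)
    {u : Fin 3 → MvPolynomial (Fin 2) K} (hu : ∀ i, (u i).IsHomogeneous (2 * k))
    {F : Fin 2 → MvPolynomial (Fin 3) K} (hF : ∀ i, (F i).IsHomogeneous 2)
    (hF_coprime : NoCommonFactor F) :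
    ∃ P ∈ bidegPart (movingIdeal u) (k - 1) 2, substF F P ≠ 0 := by
  by_contra! hcon
  let S : bihom K (k - 1) 2 →ₗ[K] homogeneousSubmodule (Fin 2) K (1 * (k - 1) + 2 * k * 2) :=
    ((aeval (Sum.elim X u)).toLinearMap ∘ₗ Submodule.subtype _).codRestrict _ fun P =>
      aeval_isHomogeneous_of_mem_bihom P.2 (isHomogeneous_X K) hu
  have h1 := S.finrank_range_add_finrank_ker
  have h2 := (LinearMap.range S).finrank_le
  rw [finrank_binary] at h2
  rw [finrank_bihom] at h1
  -- If every substitution vanished, the kernel would consist of the pencil times binary forms of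
  -- degree `k - 2`; since `k > 1`, these have dimension `k - 1`.
  have h3 : Module.finrank K (LinearMap.ker S) ≤ k - 1 := by
    let M : bihom K (k - 1 - 1) 0 →ₗ[K] TXRing K :=
      LinearMap.mulLeft K (pencil F) ∘ₗ Submodule.subtype _
    let J : LinearMap.ker S →ₗ[K] LinearMap.range M :=
      (Submodule.subtype _ ∘ₗ Submodule.subtype _).codRestrict _ fun P => by
        have hP : aeval (Sum.elim X u) P.1.1 = 0 := congrArg Subtype.val P.2
        obtain ⟨g, hg, hPg, -⟩ := exists_eq_pencil_mul hF hF_coprime P.1.2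
          (hcon _ ⟨(mem_movingIdeal_iff P.1.2).mpr hP, P.1.2⟩)
        exact ⟨⟨g, hg⟩, hPg.symm⟩
    have hJ : Function.Injective J := fun P P' hPP' => by
      have hval := congrArg Subtype.val hPP'
      exact Subtype.ext (Subtype.ext hval)
    refine (LinearMap.finrank_le_finrank_of_injective hJ).trans (M.finrank_range_le.trans ?_)
    rw [finrank_bihom]
    simp
    omega
  rw [show Nat.choose (2 + 2) 2 = 6 from rfl] at h1
  omega

end Existence

end MovingConic

end

open MovingConic

theorem proposition5p4 {K : Type*} [Field K] [IsAlgClosed K]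
    (d k : ℕ) (hd : 3 < d) (hdk : d = 2 * k)
    -- the parameterization
    (u : Fin 3 → MvPolynomial (Fin 2) K)
    (hu : ∀ i, (u i).IsHomogeneous d) (hu_coprime : MovingConic.NoCommonFactor u)
    -- its inverse, given by conics
    (F : Fin 2 → MvPolynomial (Fin 3) K)
    (hF : ∀ i, (F i).IsHomogeneous 2) (hF_coprime : MovingConic.NoCommonFactor F)
    (hinv : MovingConic.IsInverse F u)
    -- the implicit equation
    (E : MvPolynomial (Fin 3) K) (e : ℕ) (hE : E.IsHomogeneous e) (hE_irred : Irreducible E)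
    (hE_curve : MovingConic.projZeroLocus E = MovingConic.paramImage u) :
    ∃ Q : MovingConic.TXRing K,
      Q ≠ 0 ∧
      Q ∈ MovingConic.bidegPart (MovingConic.movingIdeal u) (k - 1) 2 ∧
      MovingConic.substF F Q = E ∧
      MovingConic.bidegPart (MovingConic.movingIdeal u) (k - 1) 2 =
        Submodule.span K {Q} ⊔
          MovingConic.bidegPart (Ideal.span {MovingConic.pencil F}) (k - 1) 2 ∧
      Disjoint (Submodule.span K {Q})
        (MovingConic.bidegPart (Ideal.span {MovingConic.pencil F}) (k - 1) 2) := by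
  have : Infinite K := IsAlgClosed.instInfinite
  obtain ⟨h, h0, hFu⟩ := exists_aeval_eq_X_mul hu hF hinv
  have hEu := aeval_eq_zero_of_projZeroLocus_eq (by omega) hu hE hE_irred hE_curve
  have hde := le_degree_of_aeval_eq_zero hu hu_coprime hF h0 hFu hE hE_irred.ne_zero hEu
  have hsub_smul (c : K) (P : TXRing K) : substF F (c • P) = c • substF F P := map_smul _ c P
  have hsub_sub (P P' : TXRing K) : substF F (P - P') = substF F P - substF F P' := map_sub _ P P'
  have hmul : ∀ P ∈ bidegPart (movingIdeal u) (k - 1) 2, ∃ c : K, substF F P = c • E := by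
    rintro P ⟨hP, hPb⟩
    have hhom := aeval_isHomogeneous_of_mem_bihom hPb hF (isHomogeneous_X K)
    have hdvd := dvd_of_aeval_eq_zero (by omega) hu hE hE_irred hE_curve hhom (by
      have := aeval_substF hFu hPb
      rwa [(mem_movingIdeal_iff hPb).mp hP, mul_zero] at this)
    obtain ⟨G, hG⟩ := hdvd
    -- The product `E G` has degree `2(k-1) + 2 = d ≤ e`, which forces `G` to be constant.
    obtain ⟨c, rfl⟩ := exists_eq_C_of_mul_isHomogeneous (by omega) hE (hG ▸ hhom)
      hE_irred.ne_zero
    exact ⟨c, by rw [substF, hG, smul_eq_C_mul, mul_comm]⟩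
  obtain ⟨P, hP, hP0⟩ := exists_mem_movingIdeal_substF_ne_zero (by omega) (hdk ▸ hu) hF hF_coprime
  obtain ⟨c, hc⟩ := hmul P hP
  have hc0 : c ≠ 0 := by
    rintro rfl
    exact hP0 (by rw [hc, zero_smul])
  have hQE : substF F (c⁻¹ • P) = E := by
    rw [hsub_smul, hc, inv_smul_smul₀ hc0]
  have hQ := Submodule.smul_mem _ c⁻¹ hP
  refine ⟨c⁻¹ • P, ?_, hQ, hQE, le_antisymm ?_ (sup_le ?_ ?_), ?_⟩
  · rintro h
    rw [h, substF, map_zero] at hQE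
    exact hE_irred.ne_zero hQE.symm
  · intro R hR
    obtain ⟨b, hb⟩ := hmul R hR
    -- `R - b Q` is killed by the substitution, hence is a multiple of the pencil.
    have hdiff := Submodule.sub_mem _ hR (Submodule.smul_mem _ b hQ)
    obtain ⟨g, -, hg, -⟩ := exists_eq_pencil_mul hF hF_coprime hdiff.2 (by
      rw [hsub_sub, hsub_smul, hQE, hb, sub_self])
    refine Submodule.mem_sup.mpr ⟨b • c⁻¹ • P, Submodule.smul_mem _ _
      (Submodule.mem_span_singleton_self _), R - b • c⁻¹ • P, ⟨?_, hdiff.2⟩, by abel⟩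
    exact Ideal.mem_span_singleton.mpr ⟨g, hg⟩
  · exact (Submodule.span_singleton_le_iff_mem _ _).mpr hQ
  · rintro R ⟨hR, hRb⟩
    exact ⟨(Ideal.span_singleton_le_iff_mem _).mpr (pencil_mem_movingIdeal hF hFu) hR, hRb⟩
  · rw [Submodule.disjoint_def]
    rintro R hR ⟨hRp, -⟩
    obtain ⟨b, rfl⟩ := Submodule.mem_span_singleton.mp hR
    obtain ⟨g, hg⟩ := Ideal.mem_span_singleton.mp hRp
    have h1 : substF F (b • c⁻¹ • P) = 0 := by
      have hp := substF_pencil F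
      rw [substF] at hp
      rw [hg, substF, map_mul, hp, zero_mul]
    rw [hsub_smul, hQE] at h1
    rw [(smul_eq_zero.mp h1).resolve_right hE_irred.ne_zero, zero_smul]
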